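/- Let $z>0$ be a real number that is not an integer, let $n=[z]$ be its integral part, and let $e_m(x)=\sum_{k=0}^{m}x^k/k!$ (with $e_{-1}=0$). Let $Ha^-$ be a Hankel contour in the complex plane cut along the negative real semi-axis, that is, a path $\tau(t)=r(t)e^{i\theta(t)}$, $t\in\mathbb R$, with $r$ and $\theta$ locally Lipschitz, $r>0$ and $-\pi\le\theta\le\pi$ ($\theta=\pm\pi$ being the two banks of the cut), such that $\operatorname{Re}\tau(t)\to-\infty$ as $t\to\pm\infty$, $\theta(t)<0$ for all $t$ close to $-\infty$ and $\theta(t)>0$ for all $t$ close to $+\infty$; put $\tau^z=r^ze^{iz\theta}$ on it. Then, for every such contour, $$\frac{1}{\Gamma(z)}=\frac{1}{2\pi i}\int_{Ha^-}\frac{e^{\tau}-e_{n-1}(\tau)}{\tau^{z}}\,d\tau=\frac{\sin \pi z}{\pi}\int_0^\infty\frac{e^{-\tau}-e_{n-1}(-\tau)}{\tau^{z}}\,d\tau ,$$ where the contour integral converges as an improper integral (the limit of the integrals over $[a,b]$ as $a\to-\infty$ and $b\to+\infty$ independently), and the real integral converges absolutely. For the standard contour, which consists of the ray $\arg\tau=-\delta$,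 $|\tau|\ge\varepsilon$ (coming from infinity), the arc $|\tau|=\varepsilon$, $|\arg\tau|\le\delta$, and the ray $\arg\tau=\delta$, $|\tau|\ge\varepsilon$ (going to infinity), where $\varepsilon>0$ and $\pi/2<\delta\le\pi$, the contour integral converges absolutely. -/

import Mathlib

open Filter Topology MeasureTheory

noncomputable section

/-- The truncated exponential polynomial `e_m(x) = ∑_{k=0}^{m} x^k / k!`, indexed by an integer `m`;
for `m = -1` the sum is empty, so `e_{-1} = 0`. -/
def truncExp {𝕜 : Type*} [Field 𝕜] (m : ℤ) (x : 𝕜) : 𝕜 :=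
  ∑ k ∈ Finset.range (m + 1).toNat, x ^ k / (k.factorial : 𝕜)

/-- A Hankel contour `Ha⁻` in the complex plane cut along the negative real semi-axis: a locally
Lipschitz (for instance, piecewise `C¹`) path `t ↦ r(t) e^{i θ(t)}`, `t ∈ ℝ`, given in
polar coordinates with `r > 0` and `-π ≤ θ ≤ π`, which comes from `-∞` below the cut, passes around
the origin counterclockwise, and returns to `-∞` above the cut. The values `θ = -π` and `θ = π` are
the lower and the upper bank of the cut; because `θ` is continuous, the path never crosses
the cut. -/
structure HankelContour where
  /-- the modulus along the path -/
  r : ℝ → ℝ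
  /-- the argument along the path -/
  θ : ℝ → ℝ
  r_pos : ∀ t, 0 < r t
  neg_pi_le_θ : ∀ t, -Real.pi ≤ θ t
  θ_le_pi : ∀ t, θ t ≤ Real.pi
  lipschitz_r : LocallyLipschitz r
  lipschitz_θ : LocallyLipschitz θ
  /-- the real part tends to `-∞` at the beginning of the path -/
  re_atBot : Tendsto (fun t => r t * Real.cos (θ t)) atBot atBot
  /-- the real part tends to `-∞` at the end of the path -/
  re_atTop : Tendsto (fun t => r t * Real.cos (θ t)) atTop atBot
  /-- the path begins below the cut -/
  below_atBot : ∀ᶠ t in atBot, θ t < 0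
  /-- the path ends above the cut -/
  above_atTop : ∀ᶠ t in atTop, 0 < θ t

namespace HankelContour

/-- The point `τ = r e^{iθ}` of the contour at the parameter `t`. -/
def point (γ : HankelContour) (t : ℝ) : ℂ :=
  (γ.r t : ℂ) * Complex.exp ((γ.θ t : ℂ) * Complex.I)

/-- The power `τ^z = r^z e^{izθ}` along the contour: the principal branch off the cut, with its
one-sided boundary values on the two banks of the cut. -/
def pow (γ : HankelContour) (z : ℝ) (t : ℝ) : ℂ :=
  ((γ.r t ^ z : ℝ) : ℂ) * Complex.exp (((z * γ.θ t : ℝ) : ℂ) * Complex.I)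

/-- The pullback `((e^τ - e_{n-1}(τ)) / τ^z) dτ/dt` to the parameter line of the regularized kernel,
where `n = [z]` is the integral part of `z`. -/
def kernel (γ : HankelContour) (z : ℝ) (t : ℝ) : ℂ :=
  (Complex.exp (γ.point t) - truncExp (⌊z⌋ - 1) (γ.point t)) / γ.pow z t * deriv γ.point t

/-- The standard Hankel contour made of the ray `arg τ = -δ`, `|τ| ≥ ε`, coming from infinity, the
arc `|τ| = ε`, `-δ ≤ arg τ ≤ δ`, and the ray `arg τ = δ`, `|τ| ≥ ε`, going to infinity.
For `δ = π` the two rays are the two banks of the cut. -/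
def wedge (ε δ : ℝ) (hε : 0 < ε) (hδ : Real.pi / 2 < δ) (hδ' : δ ≤ Real.pi) : HankelContour where
  r t := max ε |t|
  θ t := δ * max (-1) (min 1 (t / ε))
  r_pos t := lt_max_of_lt_left hε
  neg_pi_le_θ t := by
    have h : -1 ≤ max (-1) (min 1 (t / ε)) := le_max_left _ _
    nlinarith [Real.pi_pos]
  θ_le_pi t := by
    have h : max (-1) (min 1 (t / ε)) ≤ 1 := max_le (by norm_num) (min_le_left _ _)
    nlinarith [Real.pi_pos]
  lipschitz_r :=
    ((LipschitzWith.const ε).max (lipschitzWith_one_norm (E := ℝ))).locallyLipschitz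
  lipschitz_θ := by
    have h1 : LipschitzWith ‖ε⁻¹‖₊ (fun t : ℝ => t / ε) :=
      LipschitzWith.of_dist_le_mul fun x y => by
        rw [Real.dist_eq, Real.dist_eq, ← sub_div, div_eq_inv_mul, abs_mul]; simp
    have h2 := (h1.const_min 1).const_max (-1)
    exact ((lipschitzWith_smul δ).comp h2).locallyLipschitz
  re_atBot := by
    have hc : Real.cos δ < 0 :=
      Real.cos_neg_of_pi_div_two_lt_of_lt hδ (by linarith [Real.pi_pos])
    refine (tendsto_id.atBot_mul_const (neg_pos.2 hc)).congr' ?_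
    filter_upwards [eventually_le_atBot (-ε)] with t ht
    have h1 : t / ε ≤ -1 := by rw [div_le_iff₀ hε]; linarith
    rw [min_eq_right (by linarith), max_eq_left h1, abs_of_neg (by linarith),
      max_eq_right (by linarith)]
    simp
  re_atTop := by
    have hc : Real.cos δ < 0 :=
      Real.cos_neg_of_pi_div_two_lt_of_lt hδ (by linarith [Real.pi_pos])
    refine (tendsto_id.atTop_mul_const_of_neg hc).congr' ?_
    filter_upwards [eventually_ge_atTop ε] with t ht
    have h1 : 1 ≤ t / ε := by rw [le_div_iff₀ hε]; linarith
    have h2 : max (-1 : ℝ) 1 = 1 := max_eq_right (by norm_num)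
    rw [min_eq_left h1, h2, abs_of_pos (by linarith), max_eq_right ht]
    simp
  below_atBot := by
    filter_upwards [eventually_le_atBot (-ε)] with t ht
    have h1 : t / ε ≤ -1 := by rw [div_le_iff₀ hε]; linarith
    rw [min_eq_right (by linarith), max_eq_left h1]
    linarith [Real.pi_pos]
  above_atTop := by
    filter_upwards [eventually_ge_atTop ε] with t ht
    have h1 : 1 ≤ t / ε := by rw [le_div_iff₀ hε]; linarith
    rw [min_eq_left h1, max_eq_right (by norm_num)]
    linarith [Real.pi_pos]

end HankelContour

end

/-! In the coordinate `w = log τ` the form `(e^τ - e_{n-1}(τ)) τ^{-z} dτ` becomes `logKernel n z w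
dw`, whose coefficient is entire, so it has an entire primitive `G`. The polar data of a contour
give a lift `log r + iθ` to the `w`-plane. The integral over `[a, b]` is therefore the difference of
`G` at the two ends of the lift, and no contour has to be deformed.

What remains is the behaviour of `G` far to the right in the strip `|Im w| ≤ π`. Jordan's estimate
(`norm_sub_le_of_arc`) shows that each end of the contour may be moved along an arc to the bank `Im
w = ±π` on its side. On a bank `G` is, up to constants, a primitive of `(e^{-x} - e_{n-1}(-x))
x^{-z}`, which is absolutely integrable on `(0, ∞)` because `n < z < n + 1`. Hence `G` has a limit
along each bank. As `Re w → -∞` the values on the two banks merge (`tendsto_sub_atBot`), so the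
difference of the limits is the real integral times the jump `2i sin πz` of the phase
(`exists_tendsto_banks`).

The real integral is `Γ(1 - z)`, by induction on `n` through integration by parts
(`integral_negExpRem_div`), and Euler's reflection formula turns the result into `1/Γ(z)`. -/

/-! ### Calculus of locally Lipschitz paths -/

theorem LocallyLipschitz.contDiffAt_comp {E F : Type*} [NormedAddCommGroup E] [NormedSpace ℝ E]
    [NormedAddCommGroup F] [NormedSpace ℝ F] {f : ℝ → E} {g : E → F} (hf : LocallyLipschitz f)
    (hg : ∀ x, ContDiffAt ℝ 1 g (f x)) : LocallyLipschitz (fun x => g (f x)) := by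
  intro x
  obtain ⟨K, s, hs, hK⟩ := (hg x).exists_lipschitzOnWith
  obtain ⟨K', t, ht, hK'⟩ := hf x
  exact ⟨K * K', t ∩ f ⁻¹' s, inter_mem ht (hf.continuous.continuousAt hs),
    hK.comp (hK'.mono Set.inter_subset_left) fun y hy => hy.2⟩

theorem LocallyLipschitz.absolutelyContinuousOnInterval {f : ℝ → ℝ} (hf : LocallyLipschitz f)
    (a b : ℝ) : AbsolutelyContinuousOnInterval f a b := by
  obtain ⟨K, hK⟩ := (hf.locallyLipschitzOn (s := Set.uIcc a b)).exists_lipschitzOnWith_of_compact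
    isCompact_uIcc
  exact hK.absolutelyContinuousOnInterval

/-- Rademacher's theorem on each `[-n, n]`; the countably many exceptional null sets are united. -/
theorem LocallyLipschitz.ae_differentiableAt {f : ℝ → ℂ} (hf : LocallyLipschitz f) :
    ∀ᵐ t, DifferentiableAt ℝ f t := by
  have h : ∀ n : ℕ, ∀ᵐ t, t ∈ Set.Icc (-(n : ℝ)) n → DifferentiableWithinAt ℝ f
      (Set.Icc (-(n : ℝ)) n) t := fun n => by
    obtain ⟨K, hK⟩ := (hf.locallyLipschitzOn
      (s := Set.Icc (-(n : ℝ)) n)).exists_lipschitzOnWith_of_compact isCompact_Icc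
    exact hK.ae_differentiableWithinAt_of_mem_real
  filter_upwards [ae_all_iff.2 h] with t ht
  obtain ⟨n, hn⟩ := exists_nat_gt |t|
  have h1 := abs_lt.1 hn
  exact (ht n ⟨h1.1.le, h1.2.le⟩).differentiableAt (Icc_mem_nhds h1.1 h1.2)

/-- The real and imaginary parts are absolutely continuous on compact intervals, where the Lebesgue
form of the fundamental theorem applies. -/
theorem LocallyLipschitz.intervalIntegrable_deriv_and_integral_eq {f : ℝ → ℂ}
    (hf : LocallyLipschitz f) (a b : ℝ) :
    IntervalIntegrable (deriv f) volume a b ∧ ∫ t in a..b, deriv f t = f b - f a := by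
  have hre : LocallyLipschitz fun t => (f t).re :=
    hf.contDiffAt_comp (g := Complex.re) fun x => Complex.reCLM.contDiff.contDiffAt
  have him : LocallyLipschitz fun t => (f t).im :=
    hf.contDiffAt_comp (g := Complex.im) fun x => Complex.imCLM.contDiff.contDiffAt
  have hr := hre.absolutelyContinuousOnInterval a b
  have hi := him.absolutelyContinuousOnInterval a b
  have h1 : IntervalIntegrable (fun t => ((deriv (fun t => (f t).re) t : ℝ) : ℂ)) volume a b :=
    ⟨hr.intervalIntegrable_deriv.1.ofReal, hr.intervalIntegrable_deriv.2.ofReal⟩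
  have h2 : IntervalIntegrable (fun t => ((deriv (fun t => (f t).im) t : ℝ) : ℂ)) volume a b :=
    ⟨hi.intervalIntegrable_deriv.1.ofReal, hi.intervalIntegrable_deriv.2.ofReal⟩
  have h3 : ∀ᵐ t, ((deriv (fun t => (f t).re) t : ℝ) : ℂ)
      + ((deriv (fun t => (f t).im) t : ℝ) : ℂ) * Complex.I = deriv f t := by
    filter_upwards [hf.ae_differentiableAt] with t ht
    have e1 : HasDerivAt (fun t => (f t).re) (deriv f t).re t :=
      (Complex.reCLM.hasFDerivAt.comp_hasDerivAt t ht.hasDerivAt :)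
    have e2 : HasDerivAt (fun t => (f t).im) (deriv f t).im t :=
      (Complex.imCLM.hasFDerivAt.comp_hasDerivAt t ht.hasDerivAt :)
    rw [e1.deriv, e2.deriv, Complex.re_add_im]
  refine ⟨(h1.add (h2.mul_const Complex.I)).congr_ae (ae_restrict_of_ae h3), ?_⟩
  rw [← intervalIntegral.integral_congr_ae (h3.mono fun t h _ => h),
    intervalIntegral.integral_add h1 (h2.mul_const _), intervalIntegral.integral_mul_const,
    intervalIntegral.integral_ofReal, intervalIntegral.integral_ofReal, hr.integral_deriv_eq_sub,
    hi.integral_deriv_eq_sub]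
  apply Complex.ext <;> simp

/-! ### The kernel in the logarithmic coordinate and its arc estimates -/

/-- The remainder `e^x - e_{N-1}(x)` of the exponential series. -/
noncomputable def expRem (N : ℕ) (x : ℂ) : ℂ :=
  Complex.exp x - ∑ k ∈ Finset.range N, x ^ k / (k.factorial : ℂ)

/-- The regularized Hankel kernel in the logarithmic coordinate `w = log τ`. -/
noncomputable def logKernel (N : ℕ) (z : ℝ) (w : ℂ) : ℂ :=
  expRem N (Complex.exp w) * Complex.exp ((1 - z) * w)

theorem differentiable_logKernel (N : ℕ) (z : ℝ) : Differentiable ℂ (logKernel N z) := by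
  unfold logKernel expRem
  fun_prop

/-- The bound for small `x`; the next one serves large `x` in the left half-plane. -/
theorem norm_expRem_le (N : ℕ) (x : ℂ) : ‖expRem N x‖ ≤ ‖x‖ ^ N * Real.exp ‖x‖ :=
  Complex.norm_exp_sub_sum_le_norm_mul_exp x N

theorem norm_expRem_le' (N : ℕ) (x : ℂ) :
    ‖expRem N x‖ ≤ Real.exp x.re + ∑ k ∈ Finset.range N, ‖x‖ ^ k / (k.factorial : ℝ) := by
  refine (norm_sub_le _ _).trans (add_le_add (Complex.norm_exp x).le ?_)
  refine (norm_sum_le _ _).trans (Finset.sum_le_sum fun k _ => ?_)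
  simp

theorem norm_exp_one_sub_mul (z u φ : ℝ) :
    ‖Complex.exp ((1 - z) * (u + φ * Complex.I))‖ = Real.exp u * Real.exp (-(z * u)) := by
  rw [Complex.norm_exp, ← Real.exp_add]
  congr 1
  simp
  ring

theorem norm_exp_add_mul_I (u φ : ℝ) : ‖Complex.exp (u + φ * Complex.I)‖ = Real.exp u := by
  rw [Complex.norm_exp]; simp

theorem hasDerivAt_vertical {F G : ℂ → ℂ} (hG : ∀ w, HasDerivAt G (F w) w) (u s φ : ℝ) :
    HasDerivAt (fun φ : ℝ => G (u + (s * φ : ℝ) * Complex.I))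
      (F (u + (s * φ : ℝ) * Complex.I) * (s * Complex.I)) φ := by
  have h : HasDerivAt (fun φ : ℝ => (u : ℂ) + (s * φ : ℝ) * Complex.I) (s * Complex.I) φ := by
    have := (((hasDerivAt_id φ).const_mul s).ofReal_comp.mul_const Complex.I).const_add (u : ℂ)
    simpa using this
  exact (hG _).comp φ h

/-- Jordan's estimate on the arc of radius `e^u` between the argument `±φ` and the cut. -/
theorem norm_sub_le_of_arc {N : ℕ} {z : ℝ} {G : ℂ → ℂ}
    (hG : ∀ w, HasDerivAt G (logKernel N z w) w) (u s φ : ℝ) (hs : s = 1 ∨ s = -1)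
    (hφ : Real.pi / 2 ≤ φ) (hφ' : φ ≤ Real.pi) :
    ‖G (u + (s * Real.pi : ℝ) * Complex.I) - G (u + (s * φ : ℝ) * Complex.I)‖ ≤
      Real.pi / 2 * (Real.exp (-(z * u)) + Real.exp u * Real.exp (-(z * u)) *
        ∑ k ∈ Finset.range N, Real.exp u ^ k / (k.factorial : ℝ)) := by
  have hpi := Real.pi_pos
  set R := Real.exp u with hR
  have hR0 : 0 < R := Real.exp_pos u
  set S := ∑ k ∈ Finset.range N, R ^ k / (k.factorial : ℝ) with hS
  set E := Real.exp (-(z * u)) with hE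
  have hE0 : 0 < E := Real.exp_pos _
  have hS0 : 0 ≤ S := Finset.sum_nonneg fun k _ => by positivity
  -- The integral from `π/2` to `x` of the Jordan majorant of the integrand on the arc; it dominates
  -- the increment of `G` by comparison of derivatives.
  let B : ℝ → ℝ := fun x =>
    Real.pi / 2 * E * (1 - Real.exp (-(2 * R / Real.pi) * (x - Real.pi / 2)))
      + R * E * S * (x - Real.pi / 2)
  have hB : ∀ x, HasDerivAt B
      (R * E * (Real.exp (-(2 * R / Real.pi) * (x - Real.pi / 2)) + S)) x := fun x => by
    have h0 := (hasDerivAt_id x).sub_const (Real.pi / 2)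
    have h1 := ((((h0.const_mul (-(2 * R / Real.pi))).exp).const_sub 1).const_mul
      (Real.pi / 2 * E)).add (h0.const_mul (R * E * S))
    refine h1.congr_deriv ?_
    simp only [id]
    field_simp
  have hs1 : |s| = 1 := by rcases hs with rfl | rfl <;> simp
  have key := image_norm_le_of_norm_deriv_right_le_deriv_boundary
    (f := fun x : ℝ => G (u + (s * x : ℝ) * Complex.I) - G (u + (s * φ : ℝ) * Complex.I))
    (f' := fun x : ℝ => logKernel N z (u + (s * x : ℝ) * Complex.I) * (s * Complex.I))
    (a := φ) (b := Real.pi) (B := B)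
    (fun x _ => ((hasDerivAt_vertical hG u s x).sub_const _).continuousAt.continuousWithinAt)
    (fun x _ => ((hasDerivAt_vertical hG u s x).sub_const _).hasDerivWithinAt) ?_ hB ?_
    (Set.right_mem_Icc.2 hφ')
  · refine key.trans ?_
    have : 0 < Real.exp (-(2 * R / Real.pi) * (Real.pi - Real.pi / 2)) := Real.exp_pos _
    have h2 : 0 ≤ Real.pi / 2 * E := by positivity
    simp only [B]
    nlinarith
  · simp only [sub_self, norm_zero, B]
    have h1 : Real.exp (-(2 * R / Real.pi) * (φ - Real.pi / 2)) ≤ 1 := by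
      rw [Real.exp_le_one_iff]
      have : 0 ≤ 2 * R / Real.pi * (φ - Real.pi / 2) := mul_nonneg (by positivity) (by linarith)
      linarith
    have h2 := mul_nonneg (by positivity : 0 ≤ R * E * S) (sub_nonneg.2 hφ)
    have h3 := mul_nonneg (by positivity : 0 ≤ Real.pi / 2 * E) (sub_nonneg.2 h1)
    linarith
  · intro x hx
    rw [norm_mul, norm_mul, Complex.norm_I, Complex.norm_real, Real.norm_eq_abs, hs1, logKernel,
      norm_mul, norm_exp_one_sub_mul, mul_one, mul_one, mul_comm]
    refine mul_le_mul_of_nonneg_left ?_ (by positivity)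
    refine (norm_expRem_le' N _).trans ?_
    rw [norm_exp_add_mul_I]
    refine add_le_add_left ?_ _
    rw [Complex.exp_re, Real.exp_le_exp]
    have hc : Real.cos (s * x) = Real.cos x := by rcases hs with rfl | rfl <;> simp
    -- Jordan's inequality `sin y ≥ 2y/π` at `y = x - π/2`, where `sin y = -cos x`.
    have h1 := Real.mul_le_sin (x := x - Real.pi / 2) (by linarith [hx.1]) (by linarith [hx.2])
    rw [Real.sin_sub_pi_div_two] at h1
    have h2 := mul_le_mul_of_nonneg_left h1 hR0.le
    simp only [Complex.add_re, Complex.ofReal_re, Complex.mul_re, Complex.I_re, Complex.ofReal_im,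
      Complex.I_im, Complex.add_im, Complex.mul_im, mul_zero, mul_one, sub_zero,
      add_zero, zero_add]
    rw [hc]
    calc R * Real.cos x ≤ -(R * (2 / Real.pi * (x - Real.pi / 2))) := by linarith
      _ = _ := by ring

/-- All exponents are negative: they are `-z` and `k + 1 - z` with `k + 1 ≤ N < z`. The trivial
bound `|e^τ| ≤ 1` would give `1 - z` in place of `-z`, which fails for `z < 1`; hence Jordan's
estimate. -/
theorem tendsto_arc_bound {N : ℕ} {z : ℝ} (hz : 0 < z) (hN : (N : ℝ) < z) :
    Tendsto (fun u : ℝ => Real.pi / 2 * (Real.exp (-(z * u)) + Real.exp u * Real.exp (-(z * u)) *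
        ∑ k ∈ Finset.range N, Real.exp u ^ k / (k.factorial : ℝ))) atTop (𝓝 0) := by
  have hexp : ∀ c : ℝ, c < 0 → Tendsto (fun u : ℝ => Real.exp (c * u)) atTop (𝓝 0) := fun c hc =>
    Real.tendsto_exp_atBot.comp (tendsto_id.const_mul_atTop_of_neg hc)
  have h1 : Tendsto (fun u : ℝ => ∑ k ∈ Finset.range N,
      Real.exp ((k + 1 - z) * u) / (k.factorial : ℝ)) atTop (𝓝 0) := by
    rw [← Finset.sum_const_zero (s := Finset.range N)]
    refine tendsto_finsetSum _ fun k hk => ?_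
    have : (k : ℝ) + 1 ≤ N := by exact_mod_cast Finset.mem_range.1 hk
    simpa using (hexp (k + 1 - z) (by linarith)).div_const (k.factorial : ℝ)
  have h2 := ((hexp (-z) (by linarith)).add h1).const_mul (Real.pi / 2)
  rw [add_zero, mul_zero] at h2
  refine h2.congr fun u => ?_
  rw [Finset.mul_sum, neg_mul]
  congr 2
  refine Finset.sum_congr rfl fun k _ => ?_
  rw [← Real.exp_nat_mul, mul_div_assoc', ← Real.exp_add, ← Real.exp_add]
  ring_nf

/-- The remainder vanishes to order `N` at the origin, so on the vertical segment of length `2π` the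
kernel is `O(e^{(N+1-z)u})`, with a positive exponent. -/
theorem tendsto_sub_atBot {N : ℕ} {z : ℝ} {G : ℂ → ℂ}
    (hG : ∀ w, HasDerivAt G (logKernel N z w) w) (hN : z < N + 1) :
    Tendsto (fun u : ℝ => G (u + (1 * Real.pi : ℝ) * Complex.I)
      - G (u + ((-1) * Real.pi : ℝ) * Complex.I)) atBot (𝓝 0) := by
  have hpi := Real.pi_pos
  have hle : ∀ u : ℝ, ‖G (u + (1 * Real.pi : ℝ) * Complex.I)
      - G (u + ((-1) * Real.pi : ℝ) * Complex.I)‖ ≤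
      Real.exp ((N + 1 - z) * u) * Real.exp (Real.exp u) * (2 * Real.pi) := fun u => by
    have := norm_image_sub_le_of_norm_deriv_le_segment'
      (f := fun x : ℝ => G (u + (1 * x : ℝ) * Complex.I))
      (a := -Real.pi) (b := Real.pi)
      (C := Real.exp ((N + 1 - z) * u) * Real.exp (Real.exp u))
      (fun x _ => (hasDerivAt_vertical hG u 1 x).hasDerivWithinAt) ?_ Real.pi
      (Set.right_mem_Icc.2 (by linarith))
    · simpa [two_mul] using this
    · intro x _
      rw [norm_mul, norm_mul, Complex.norm_I, Complex.norm_real, norm_one, logKernel,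
        norm_mul, norm_exp_one_sub_mul, mul_one, mul_one]
      have h1 := norm_expRem_le N (Complex.exp (u + (1 * x : ℝ) * Complex.I))
      rw [norm_exp_add_mul_I] at h1
      refine (mul_le_mul_of_nonneg_right h1 (by positivity)).trans_eq ?_
      rw [← Real.exp_nat_mul, ← Real.exp_add, ← Real.exp_add, ← Real.exp_add, ← Real.exp_add]
      ring_nf
  refine squeeze_zero_norm hle ?_
  have h1 : Tendsto (fun u : ℝ => Real.exp ((N + 1 - z) * u)) atBot (𝓝 0) :=
    Real.tendsto_exp_atBot.comp (tendsto_id.const_mul_atBot (by linarith))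
  have h2 : Tendsto (fun u : ℝ => Real.exp (Real.exp u)) atBot (𝓝 1) := by
    simpa [Function.comp_def] using (Real.continuous_exp.tendsto 0).comp Real.tendsto_exp_atBot
  simpa using (h1.mul h2).mul_const (2 * Real.pi)

/-! ### The real integral and its value `Γ(1 - z)` -/

/-- The remainder `e^{-x} - e_{N-1}(-x)` of the exponential series on the negative semi-axis. -/
noncomputable def negExpRem (N : ℕ) (x : ℝ) : ℝ :=
  Real.exp (-x) - ∑ k ∈ Finset.range N, (-x) ^ k / (k.factorial : ℝ)

theorem ofReal_negExpRem (N : ℕ) (x : ℝ) : ((negExpRem N x : ℝ) : ℂ) = expRem N (-x) := by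
  simp [negExpRem, expRem]

theorem continuous_negExpRem (N : ℕ) : Continuous (negExpRem N) := by
  unfold negExpRem
  fun_prop

theorem hasDerivAt_negExpRem_succ (N : ℕ) (x : ℝ) :
    HasDerivAt (negExpRem (N + 1)) (-negExpRem N x) x := by
  have h1 : HasDerivAt (fun x : ℝ => Real.exp (-x)) (-Real.exp (-x)) x := by
    simpa using (hasDerivAt_neg x).exp
  have h2 : HasDerivAt (fun x : ℝ => ∑ k ∈ Finset.range (N + 1), (-x) ^ k / (k.factorial : ℝ))
      (-∑ k ∈ Finset.range N, (-x) ^ k / (k.factorial : ℝ)) x := by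
    simp_rw [Finset.sum_range_succ' _ N]
    have h3 : ∀ k ∈ Finset.range N, HasDerivAt
        (fun x : ℝ => (-x) ^ (k + 1) / ((k + 1).factorial : ℝ))
        (-((-x) ^ k / (k.factorial : ℝ))) x := fun k _ => by
      have := ((hasDerivAt_neg x).pow (k + 1)).div_const ((k + 1).factorial : ℝ)
      refine this.congr_deriv ?_
      have h0 : (k.factorial : ℝ) ≠ 0 := by positivity
      have h1 : (k : ℝ) + 1 ≠ 0 := by positivity
      rw [Nat.factorial_succ]
      push_cast
      field_simp
    rw [← Finset.sum_neg_distrib]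
    simpa using (HasDerivAt.fun_sum h3).add_const 1
  refine (h1.sub h2).congr_deriv ?_
  rw [negExpRem]
  ring

theorem abs_negExpRem_le (N : ℕ) {x : ℝ} (hx : 0 ≤ x) :
    |negExpRem N x| ≤ x ^ N * Real.exp x := by
  have h := norm_expRem_le N (-x)
  rwa [← ofReal_negExpRem, norm_neg, Complex.norm_real, Complex.norm_real, Real.norm_of_nonneg hx]
    at h

theorem abs_negExpRem_le' (N : ℕ) {x : ℝ} (hx : 0 ≤ x) :
    |negExpRem N x| ≤ Real.exp (-x) + ∑ k ∈ Finset.range N, x ^ k / (k.factorial : ℝ) := by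
  have h := norm_expRem_le' N (-x)
  rw [← ofReal_negExpRem, norm_neg, Complex.norm_real, Complex.norm_real, Real.norm_of_nonneg hx]
    at h
  simpa using h

theorem integrableOn_exp_add_sum_div {N : ℕ} {z c : ℝ} (hz : 0 < z) (hN : (N : ℝ) < z)
    (hc : c < 0) :
    IntegrableOn (fun x : ℝ => (Real.exp (c * x)
      + ∑ k ∈ Finset.range N, x ^ k / (k.factorial : ℝ)) / x ^ z) (Set.Ioi 1) := by
  have hexp : Integrable (fun x : ℝ => Real.exp (c * x) / x ^ z)
      (volume.restrict (Set.Ioi 1)) := by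
    have he : IntegrableOn (fun x : ℝ => Real.exp (c * x)) (Set.Ioi 1) := by
      simpa using exp_neg_integrableOn_Ioi 1 (neg_pos.2 hc)
    refine he.mono' (ContinuousOn.aestronglyMeasurable (fun x hx => ?_) measurableSet_Ioi) ?_
    · have hx0 : 0 < x := zero_lt_one.trans hx
      exact (ContinuousAt.div (by fun_prop) (Real.continuousAt_rpow_const _ _ (Or.inl hx0.ne'))
        (Real.rpow_pos_of_pos hx0 z).ne').continuousWithinAt
    · filter_upwards [ae_restrict_mem measurableSet_Ioi] with x hx
      have hp := Real.rpow_pos_of_pos (zero_lt_one.trans hx) z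
      rw [norm_div, Real.norm_of_nonneg (Real.exp_pos _).le, Real.norm_of_nonneg hp.le]
      exact div_le_self (Real.exp_pos _).le (Real.one_le_rpow (le_of_lt hx) hz.le)
  have hsum : Integrable (fun x : ℝ => ∑ k ∈ Finset.range N,
      x ^ ((k : ℝ) - z) / (k.factorial : ℝ)) (volume.restrict (Set.Ioi 1)) := by
    refine integrable_finsetSum _ fun k hk => ?_
    have : (k : ℝ) + 1 ≤ N := by exact_mod_cast Finset.mem_range.1 hk
    exact Integrable.div_const (integrableOn_Ioi_rpow_of_lt (by linarith) one_pos) _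
  refine (hexp.add hsum).congr ?_
  filter_upwards [ae_restrict_mem measurableSet_Ioi] with x hx
  rw [Pi.add_apply, add_div, Finset.sum_div]
  congr 1
  refine Finset.sum_congr rfl fun k _ => ?_
  rw [Real.rpow_sub (zero_lt_one.trans hx), Real.rpow_natCast, div_right_comm]

/-- Near `0` the integrand is `O(x^{N-z})` with `N - z > -1`; at infinity the worst power is
`x^{N-1-z}`, with exponent below `-1`. -/
theorem integrableOn_negExpRem_div {N : ℕ} {z : ℝ} (hz : 0 < z) (h1 : (N : ℝ) < z)
    (h2 : z < N + 1) : IntegrableOn (fun x => negExpRem N x / x ^ z) (Set.Ioi 0) := by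
  have hcont : ContinuousOn (fun x => negExpRem N x / x ^ z) (Set.Ioi 0) := fun x hx =>
    ((continuous_negExpRem N).continuousAt.div
      (Real.continuousAt_rpow_const _ _ (Or.inl (ne_of_gt hx)))
      (Real.rpow_pos_of_pos hx z).ne').continuousWithinAt
  rw [← Set.Ioc_union_Ioi_eq_Ioi (zero_le_one (α := ℝ)), integrableOn_union]
  constructor
  · have hb : IntegrableOn (fun x : ℝ => Real.exp 1 * x ^ ((N : ℝ) - z)) (Set.Ioc 0 1) :=
      ((intervalIntegral.intervalIntegrable_rpow' (by linarith)).const_mul _).1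
    refine hb.mono' ((hcont.mono fun x hx => hx.1).aestronglyMeasurable measurableSet_Ioc) ?_
    filter_upwards [ae_restrict_mem measurableSet_Ioc] with x hx
    have hp := Real.rpow_pos_of_pos hx.1 z
    rw [norm_div, Real.norm_eq_abs, Real.norm_of_nonneg hp.le, Real.rpow_sub hx.1,
      Real.rpow_natCast, mul_div_assoc']
    refine div_le_div_of_nonneg_right ((abs_negExpRem_le N hx.1.le).trans ?_) hp.le
    rw [mul_comm]
    exact mul_le_mul_of_nonneg_right (Real.exp_le_exp.2 hx.2) (pow_nonneg hx.1.le _)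
  · refine (integrableOn_exp_add_sum_div hz h1 neg_one_lt_zero).mono'
      ((hcont.mono (Set.Ioi_subset_Ioi zero_le_one)).aestronglyMeasurable measurableSet_Ioi) ?_
    filter_upwards [ae_restrict_mem measurableSet_Ioi] with x hx
    have hx0 : 0 < x := zero_lt_one.trans hx
    have hp := Real.rpow_pos_of_pos hx0 z
    rw [norm_div, Real.norm_eq_abs, Real.norm_of_nonneg hp.le, neg_one_mul]
    exact div_le_div_of_nonneg_right (abs_negExpRem_le' N hx0.le) hp.le

theorem tendsto_negExpRem_mul_rpow_atTop {N : ℕ} {p : ℝ} (hp : p < 0) (h : (N : ℝ) + p < 1) :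
    Tendsto (fun x => negExpRem N x * x ^ p) atTop (𝓝 0) := by
  have hneg : ∀ c : ℝ, c < 0 → Tendsto (fun x : ℝ => x ^ c) atTop (𝓝 0) := fun c hc => by
    simpa using tendsto_rpow_neg_atTop (neg_pos.2 hc)
  have h1 : Tendsto (fun x : ℝ => Real.exp (-x) * x ^ p) atTop (𝓝 0) := by
    simpa using (Real.tendsto_exp_neg_atTop_nhds_zero).mul (hneg p hp)
  have h2 : Tendsto (fun x : ℝ => ∑ k ∈ Finset.range N, x ^ ((k : ℝ) + p) / (k.factorial : ℝ))
      atTop (𝓝 0) := by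
    rw [← Finset.sum_const_zero (s := Finset.range N)]
    refine tendsto_finsetSum _ fun k hk => ?_
    have : (k : ℝ) + 1 ≤ N := by exact_mod_cast Finset.mem_range.1 hk
    simpa using (hneg (k + p) (by linarith)).div_const (k.factorial : ℝ)
  have h3 := h1.add h2
  rw [add_zero] at h3
  refine squeeze_zero_norm' ?_ h3
  filter_upwards [eventually_gt_atTop 0] with x hx
  have hp := Real.rpow_pos_of_pos hx p
  rw [norm_mul, Real.norm_eq_abs, Real.norm_of_nonneg hp.le]
  refine (mul_le_mul_of_nonneg_right (abs_negExpRem_le' N hx.le) hp.le).trans_eq ?_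
  rw [add_mul, Finset.sum_mul]
  congr 1
  refine Finset.sum_congr rfl fun k _ => ?_
  rw [Real.rpow_add hx, Real.rpow_natCast]
  ring

theorem tendsto_negExpRem_mul_rpow_zero {N : ℕ} {p : ℝ} (h : 0 < (N : ℝ) + p) :
    Tendsto (fun x => negExpRem N x * x ^ p) (𝓝[>] 0) (𝓝 0) := by
  have h1 : Tendsto (fun x : ℝ => x ^ ((N : ℝ) + p) * Real.exp x) (𝓝[>] 0) (𝓝 0) := by
    have : ContinuousAt (fun x : ℝ => x ^ ((N : ℝ) + p) * Real.exp x) 0 :=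
      (Real.continuousAt_rpow_const _ _ (Or.inr h.le)).mul Real.continuous_exp.continuousAt
    have := this.tendsto
    rw [Real.zero_rpow h.ne', zero_mul] at this
    exact this.mono_left nhdsWithin_le_nhds
  refine squeeze_zero_norm' ?_ h1
  filter_upwards [self_mem_nhdsWithin] with x hx
  have hx : 0 < x := hx
  have hp := Real.rpow_pos_of_pos hx p
  rw [norm_mul, Real.norm_eq_abs, Real.norm_of_nonneg hp.le]
  refine (mul_le_mul_of_nonneg_right (abs_negExpRem_le N hx.le) hp.le).trans_eq ?_
  rw [Real.rpow_add hx, Real.rpow_natCast]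
  ring

/-- The Cauchy–Saalschütz representation of the Gamma function at negative arguments. -/
theorem integral_negExpRem_div {N : ℕ} {z : ℝ} (hz : 0 < z) (h1 : (N : ℝ) < z) (h2 : z < N + 1) :
    ∫ x in Set.Ioi 0, negExpRem N x / x ^ z = Real.Gamma (1 - z) := by
  induction N generalizing z with
  | zero =>
    rw [Real.Gamma_eq_integral (by simpa using h2)]
    refine setIntegral_congr_fun measurableSet_Ioi fun x hx => ?_
    simp [negExpRem, Real.rpow_neg (le_of_lt hx), div_eq_mul_inv]
  | succ N ih =>
    push_cast at h1 h2
    have hN : (0 : ℝ) ≤ N := N.cast_nonneg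
    have hz1 : 1 - z < 0 := by linarith
    have hint := integrableOn_negExpRem_div (N := N + 1) hz (by push_cast; linarith)
      (by push_cast; linarith)
    have hint' := integrableOn_negExpRem_div (N := N) (z := z - 1) (by linarith) (by linarith)
      (by linarith)
    have hint'' : IntegrableOn (fun x => -(1 - z)⁻¹ * (negExpRem N x / x ^ (z - 1)))
        (Set.Ioi 0) := Integrable.const_mul hint' _
    have hcongr : Set.EqOn (fun x => -negExpRem N x * (x ^ (1 - z) / (1 - z)))
        (fun x => -(1 - z)⁻¹ * (negExpRem N x / x ^ (z - 1))) (Set.Ioi 0) := fun x hx => by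
      have : x ^ (1 - z) = (x ^ (z - 1))⁻¹ := by rw [← Real.rpow_neg (le_of_lt hx), neg_sub]
      simp only [this]
      ring
    have hcongr' : Set.EqOn (fun x => negExpRem (N + 1) x * x ^ (-z))
        (fun x => negExpRem (N + 1) x / x ^ z) (Set.Ioi 0) := fun x hx => by
      simp only [Real.rpow_neg (le_of_lt hx), div_eq_mul_inv]
    -- Integration by parts lowers `N` and `z` together by one, preserving `N < z < N + 1`; both
    -- boundary terms vanish. The factor `1 - z` is absorbed by `Γ(2 - z) = (1 - z) Γ(1 - z)`.
    have hparts := integral_Ioi_mul_deriv_eq_deriv_mul (a := (0 : ℝ)) (a' := 0) (b' := 0)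
      (u := negExpRem (N + 1)) (u' := fun x => -negExpRem N x)
      (v := fun x => x ^ (1 - z) / (1 - z)) (v' := fun x => x ^ (-z))
      (fun x _ => hasDerivAt_negExpRem_succ N x) (fun x hx => ?_)
      (hint.congr_fun hcongr'.symm measurableSet_Ioi)
      (hint''.congr_fun hcongr.symm measurableSet_Ioi) ?_ ?_
    · rw [setIntegral_congr_fun measurableSet_Ioi hcongr',
        setIntegral_congr_fun measurableSet_Ioi hcongr, integral_const_mul,
        ih (by linarith) (by linarith) (by linarith), show 1 - (z - 1) = (1 - z) + 1 by ring,
        Real.Gamma_add_one hz1.ne] at hparts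
      simpa [inv_mul_cancel_left₀ hz1.ne] using hparts
    · have := (Real.hasDerivAt_rpow_const (x := x) (p := 1 - z)
        (Or.inl (ne_of_gt hx))).div_const (1 - z)
      rwa [mul_div_cancel_left₀ _ hz1.ne, show 1 - z - 1 = -z by ring] at this
    · have := (tendsto_negExpRem_mul_rpow_zero (N := N + 1) (p := 1 - z)
        (by push_cast; linarith)).div_const (1 - z)
      rw [zero_div] at this
      exact this.congr fun x => mul_div_assoc _ _ _
    · have := (tendsto_negExpRem_mul_rpow_atTop (N := N + 1) (p := 1 - z) hz1
        (by push_cast; linarith)).div_const (1 - z)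
      rw [zero_div] at this
      exact this.congr fun x => mul_div_assoc _ _ _

/-! ### The primitive on the two banks of the cut -/

/-- On either bank (`s = 1` upper, `s = -1` lower) `e^w = -x` and `dw = dx/x`, so the two
derivatives differ only in the constant phase `e^{±iπ(1-z)}`. -/
theorem hasDerivAt_comp_log {N : ℕ} {z : ℝ} {G : ℂ → ℂ}
    (hG : ∀ w, HasDerivAt G (logKernel N z w) w) {s : ℝ} (hs : s = 1 ∨ s = -1) {x : ℝ}
    (hx : 0 < x) :
    HasDerivAt (fun x : ℝ => G (Real.log x + (s * Real.pi : ℝ) * Complex.I))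
      (Complex.exp ((1 - z) * (s * Real.pi : ℝ) * Complex.I) * ((negExpRem N x / x ^ z : ℝ) : ℂ))
      x := by
  have h : HasDerivAt (fun x : ℝ => (Real.log x : ℂ) + (s * Real.pi : ℝ) * Complex.I)
      ((x⁻¹ : ℝ) : ℂ) x :=
    ((Real.hasDerivAt_log hx.ne').ofReal_comp).add_const _
  refine ((hG _).comp x h).congr_deriv ?_
  have h1 : Complex.exp (Real.log x + (s * Real.pi : ℝ) * Complex.I) = -x := by
    rw [Complex.exp_add, ← Complex.ofReal_exp, Real.exp_log hx]
    rcases hs with rfl | rfl <;> simp [Complex.exp_neg]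
  have h2 : Complex.exp ((1 - z) * (Real.log x + (s * Real.pi : ℝ) * Complex.I))
      = ((x / x ^ z : ℝ) : ℂ) * Complex.exp ((1 - z) * (s * Real.pi : ℝ) * Complex.I) := by
    rw [mul_add, Complex.exp_add, mul_assoc]
    congr 1
    have : x / x ^ z = Real.exp ((1 - z) * Real.log x) := by
      rw [mul_comm, ← Real.rpow_def_of_pos hx, Real.rpow_sub hx, Real.rpow_one]
    rw [this]
    push_cast
    rfl
  rw [logKernel, h1, h2, ← ofReal_negExpRem]
  have hx' : (x : ℂ) ≠ 0 := by exact_mod_cast hx.ne'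
  push_cast
  field_simp

/-- The limits of a primitive of the logarithmic kernel far out on the two banks of the cut exist,
and their difference is the jump of the Hankel integral across the cut. -/
theorem exists_tendsto_banks {N : ℕ} {z : ℝ} (hz : 0 < z) (h1 : (N : ℝ) < z) (h2 : z < N + 1)
    {G : ℂ → ℂ} (hG : ∀ w, HasDerivAt G (logKernel N z w) w) :
    ∃ L : ℝ → ℂ, (∀ s : ℝ, s = 1 ∨ s = -1 →
      Tendsto (fun u : ℝ => G (u + (s * Real.pi : ℝ) * Complex.I)) atTop (𝓝 (L s))) ∧
      L 1 - L (-1) = 2 * Complex.I * (Real.sin (Real.pi * z) * Real.Gamma (1 - z) : ℝ) := by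
  let c : ℝ → ℂ := fun s => Complex.exp ((1 - z) * (s * Real.pi : ℝ) * Complex.I)
  let H : ℝ → ℂ := fun x => ((negExpRem N x / x ^ z : ℝ) : ℂ)
  let g : ℝ → ℝ → ℂ := fun s u => G (u + (s * Real.pi : ℝ) * Complex.I)
  have hH : IntegrableOn H (Set.Ioi 0) := (integrableOn_negExpRem_div hz h1 h2).ofReal
  have hsub : ∀ {a b : ℝ}, 0 ≤ a → 0 ≤ b → IntervalIntegrable H volume a b := fun ha hb =>
    ⟨hH.mono_set fun x hx => ha.trans_lt hx.1, hH.mono_set fun x hx => hb.trans_lt hx.1⟩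
  have hftc : ∀ s, s = 1 ∨ s = -1 → ∀ u : ℝ,
      c s * ∫ x in (1 : ℝ)..Real.exp u, H x = g s u - g s 0 := fun s hs u => by
    have hpos : ∀ x ∈ Set.uIcc 1 (Real.exp u), 0 < x := fun x hx =>
      (lt_min one_pos (Real.exp_pos u)).trans_le hx.1
    have := intervalIntegral.integral_eq_sub_of_hasDerivAt
      (fun x hx => hasDerivAt_comp_log hG hs (hpos x hx))
      ((hsub zero_le_one (Real.exp_pos u).le).const_mul (c s))
    rw [intervalIntegral.integral_const_mul] at this
    rw [this]
    simp [g]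
  have hg : ∀ s, s = 1 ∨ s = -1 → ∀ u : ℝ,
      g s u = g s 0 + c s * ∫ x in (1 : ℝ)..Real.exp u, H x := fun s hs u => by
    rw [hftc s hs u]; ring
  have htop : Tendsto (fun u => ∫ x in (1 : ℝ)..Real.exp u, H x) atTop
      (𝓝 (∫ x in Set.Ioi 1, H x)) :=
    intervalIntegral_tendsto_integral_Ioi 1
      (hH.mono_set (Set.Ioi_subset_Ioi zero_le_one)) Real.tendsto_exp_atTop
  have hbot : Tendsto (fun u => ∫ x in (1 : ℝ)..Real.exp u, H x) atBot
      (𝓝 (∫ x in (1 : ℝ)..0, H x)) := by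
    have hc := intervalIntegral.continuousOn_primitive_interval' (μ := volume)
      (hsub (zero_le_one (α := ℝ)) le_rfl).symm (a := 1) (by simp)
    have hc0 := hc 0 (by simp)
    refine Tendsto.comp hc0 (tendsto_nhdsWithin_iff.2 ⟨Real.tendsto_exp_atBot, ?_⟩)
    filter_upwards [eventually_le_atBot 0] with u hu
    rw [Set.uIcc_of_le zero_le_one]
    exact ⟨(Real.exp_pos u).le, Real.exp_le_one_iff.2 hu⟩
  refine ⟨fun s => g s 0 + c s * ∫ x in Set.Ioi 1, H x, fun s hs => ?_, ?_⟩
  · exact ((htop.const_mul (c s)).const_add (g s 0)).congr fun u => (hg s hs u).symm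
  -- Comparing the banks at the origin, where they merge, eliminates the unknown constants `g s 0`.
  · have hlim : ∀ s, s = 1 ∨ s = -1 →
        Tendsto (g s) atBot (𝓝 (g s 0 + c s * ∫ x in (1 : ℝ)..0, H x)) := fun s hs =>
      ((hbot.const_mul (c s)).const_add (g s 0)).congr fun u => (hg s hs u).symm
    have h0 := tendsto_nhds_unique ((hlim 1 (Or.inl rfl)).sub (hlim (-1) (Or.inr rfl)))
      (tendsto_sub_atBot hG h2)
    have hsplit : (∫ x in Set.Ioi 1, H x) - ∫ x in (1 : ℝ)..0, H x = Real.Gamma (1 - z) := by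
      rw [intervalIntegral.integral_symm, sub_neg_eq_add, add_comm,
        intervalIntegral.integral_interval_add_Ioi hH
          (hH.mono_set (Set.Ioi_subset_Ioi zero_le_one)),
        integral_complex_ofReal, integral_negExpRem_div hz h1 h2]
    have hc : c 1 - c (-1) = 2 * Complex.I * Real.sin (Real.pi * z) := by
      have e : Real.sin (Real.pi * z) = Real.sin ((1 - z) * Real.pi) := by
        rw [← Real.sin_pi_sub]; ring_nf
      have e1 : c 1 = Complex.exp (((1 - z) * Real.pi : ℝ) * Complex.I) := by
        simp only [c]; push_cast; ring_nf
      have e2 : c (-1) = Complex.exp (-((1 - z) * Real.pi : ℝ) * Complex.I) := by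
        simp only [c]; push_cast; ring_nf
      rw [e, Complex.ofReal_sin, Complex.sin, e1, e2]
      linear_combination (-Complex.exp (-((1 - z) * Real.pi : ℝ) * Complex.I)
        + Complex.exp (((1 - z) * Real.pi : ℝ) * Complex.I)) * Complex.I_sq
    rw [Complex.ofReal_mul, ← hsplit, ← mul_assoc, ← hc]
    linear_combination h0

/-! ### The integral part of `z` and the reflection formula -/

theorem truncExp_floor_sub_one {𝕜 : Type*} [Field 𝕜] (z : ℝ) (x : 𝕜) :
    truncExp (⌊z⌋ - 1) x = ∑ k ∈ Finset.range ⌊z⌋.toNat, x ^ k / (k.factorial : 𝕜) := by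
  rw [truncExp, sub_add_cancel]

theorem one_div_Gamma_eq_sin_mul_Gamma {z : ℝ} (hz : 0 < z) (hzint : ∀ m : ℤ, z ≠ (m : ℝ)) :
    1 / Real.Gamma z = Real.sin (Real.pi * z) / Real.pi * Real.Gamma (1 - z) := by
  have h := Real.Gamma_mul_Gamma_one_sub z
  have hG := (Real.Gamma_pos_of_pos hz).ne'
  have hs : Real.sin (Real.pi * z) ≠ 0 := fun h0 => by
    obtain ⟨m, hm⟩ := Real.sin_eq_zero_iff.1 h0
    exact hzint m (mul_left_cancel₀ Real.pi_ne_zero (by linarith))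
  rw [eq_div_iff hs] at h
  have := Real.pi_ne_zero
  field_simp
  linarith

theorem floor_toNat_lt_and_lt {z : ℝ} (hz : 0 < z) (hzint : ∀ m : ℤ, z ≠ (m : ℝ)) :
    (⌊z⌋.toNat : ℝ) < z ∧ z < ⌊z⌋.toNat + 1 := by
  have h : ((⌊z⌋.toNat : ℤ) : ℝ) = ⌊z⌋ := by rw [Int.toNat_of_nonneg (Int.floor_nonneg.2 hz.le)]
  rw [Int.cast_natCast] at h
  rw [h]
  exact ⟨lt_of_le_of_ne (Int.floor_le z) (hzint _).symm, Int.lt_floor_add_one z⟩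

theorem truncExp_eq_negExpRem (z x : ℝ) :
    Real.exp (-x) - truncExp (⌊z⌋ - 1) (-x) = negExpRem ⌊z⌋.toNat x := by
  rw [truncExp_floor_sub_one, negExpRem]

/-! ### Hankel contours in the logarithmic coordinate -/

namespace HankelContour

/-- The logarithm `log r + iθ` of the point of the contour. -/
noncomputable def logPoint (γ : HankelContour) (t : ℝ) : ℂ :=
  (Real.log (γ.r t) : ℂ) + (γ.θ t : ℂ) * Complex.I

theorem exp_logPoint (γ : HankelContour) (t : ℝ) : Complex.exp (γ.logPoint t) = γ.point t := by
  rw [logPoint, Complex.exp_add, ← Complex.ofReal_exp, Real.exp_log (γ.r_pos t), point]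

theorem exp_mul_logPoint (γ : HankelContour) (z t : ℝ) :
    Complex.exp (z * γ.logPoint t) = γ.pow z t := by
  rw [logPoint, mul_add, Complex.exp_add, pow, Real.rpow_def_of_pos (γ.r_pos t)]
  push_cast
  ring_nf

theorem locallyLipschitz_logPoint (γ : HankelContour) : LocallyLipschitz γ.logPoint := by
  refine (γ.lipschitz_r.prodMk γ.lipschitz_θ).contDiffAt_comp
    (g := fun p : ℝ × ℝ => (Real.log p.1 : ℂ) + (p.2 : ℂ) * Complex.I) fun t => ?_
  have h1 : ContDiffAt ℝ 1 (fun p : ℝ × ℝ => (Real.log p.1 : ℂ)) (γ.r t, γ.θ t) :=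
    Complex.ofRealCLM.contDiff.contDiffAt.comp _ (contDiffAt_fst.log (γ.r_pos t).ne')
  have h2 : ContDiffAt ℝ 1 (fun p : ℝ × ℝ => (p.2 : ℂ)) (γ.r t, γ.θ t) :=
    Complex.ofRealCLM.contDiff.contDiffAt.comp _ contDiffAt_snd
  exact h1.add (h2.mul contDiffAt_const)

theorem kernel_eq (γ : HankelContour) (z t : ℝ) :
    γ.kernel z t = expRem ⌊z⌋.toNat (γ.point t) / γ.pow z t * deriv γ.point t := by
  rw [kernel, truncExp_floor_sub_one, expRem]

/-- The substitution `τ = e^w`, under which `τ^{-z} dτ = e^{(1-z)w} dw`, at the points where the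
lift is differentiable. -/
theorem ae_deriv_comp_logPoint_eq_kernel (γ : HankelContour) (z : ℝ) {G : ℂ → ℂ}
    (hG : ∀ w, HasDerivAt G (logKernel ⌊z⌋.toNat z w) w) :
    ∀ᵐ t, deriv (fun t => G (γ.logPoint t)) t = γ.kernel z t := by
  filter_upwards [γ.locallyLipschitz_logPoint.ae_differentiableAt] with t ht
  have h1 : HasDerivAt (fun t => G (γ.logPoint t)) _ t := (hG _).comp t ht.hasDerivAt
  have h2 : HasDerivAt γ.point _ t :=
    (ht.hasDerivAt.cexp).congr_of_eventuallyEq (.of_forall fun t => (γ.exp_logPoint t).symm)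
  rw [h1.deriv, kernel_eq, h2.deriv, logKernel, sub_mul, one_mul, Complex.exp_sub,
    exp_logPoint, exp_mul_logPoint]
  ring

theorem intervalIntegrable_kernel_and_integral_eq (γ : HankelContour) (z : ℝ) {G : ℂ → ℂ}
    (hG : ∀ w, HasDerivAt G (logKernel ⌊z⌋.toNat z w) w) (a b : ℝ) :
    IntervalIntegrable (γ.kernel z) volume a b ∧
      ∫ t in a..b, γ.kernel z t = G (γ.logPoint b) - G (γ.logPoint a) := by
  have hdiff : Differentiable ℂ G := fun w => (hG w).differentiableAt
  have hlip : LocallyLipschitz fun t => G (γ.logPoint t) :=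
    γ.locallyLipschitz_logPoint.contDiffAt_comp fun t =>
      (hdiff.contDiff (n := 1)).contDiffAt.restrict_scalars ℝ
  have hae := γ.ae_deriv_comp_logPoint_eq_kernel z hG
  obtain ⟨h1, h2⟩ := hlip.intervalIntegrable_deriv_and_integral_eq a b
  refine ⟨h1.congr_ae (ae_restrict_of_ae hae), ?_⟩
  rw [← h2]
  exact intervalIntegral.integral_congr_ae (hae.mono fun t h _ => h.symm)

/-- The end of the contour is compared with the point of the bank at the same modulus; the
connecting arc contributes nothing in the limit. -/
theorem tendsto_comp_logPoint (γ : HankelContour) {N : ℕ} {z : ℝ} (hz : 0 < z)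
    (hN : (N : ℝ) < z) {G : ℂ → ℂ} (hG : ∀ w, HasDerivAt G (logKernel N z w) w) {s : ℝ}
    (hs : s = 1 ∨ s = -1) {L : ℂ}
    (hL : Tendsto (fun u : ℝ => G (u + (s * Real.pi : ℝ) * Complex.I)) atTop (𝓝 L))
    {l : Filter ℝ} (hre : Tendsto (fun t => γ.r t * Real.cos (γ.θ t)) l atBot)
    (hθ : ∀ᶠ t in l, 0 < s * γ.θ t) : Tendsto (fun t => G (γ.logPoint t)) l (𝓝 L) := by
  have hr : Tendsto γ.r l atTop := by
    refine tendsto_atTop_mono (fun t => ?_) (tendsto_neg_atBot_atTop.comp hre)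
    have := Real.neg_one_le_cos (γ.θ t)
    have := γ.r_pos t
    simp only [Function.comp]
    nlinarith
  have hlog := Real.tendsto_log_atTop.comp hr
  have hdiff : Tendsto (fun t => G (Real.log (γ.r t) + (s * Real.pi : ℝ) * Complex.I)
      - G (γ.logPoint t)) l (𝓝 0) := by
    refine squeeze_zero_norm' ?_ ((tendsto_arc_bound hz hN).comp hlog)
    filter_upwards [hθ, hre.eventually (eventually_lt_atBot 0)] with t h1 h2
    have hss : s * (s * γ.θ t) = γ.θ t := by rcases hs with rfl | rfl <;> simp
    have hcos : Real.cos (s * γ.θ t) = Real.cos (γ.θ t) := by rcases hs with rfl | rfl <;> simp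
    -- A negative real part puts the point in the left half-plane, where Jordan's estimate applies.
    have hlow : Real.pi / 2 ≤ s * γ.θ t := by
      by_contra! h
      have h3 := Real.cos_pos_of_mem_Ioo ⟨by linarith [Real.pi_pos], h⟩
      rw [hcos] at h3
      exact absurd h2 (mul_pos (γ.r_pos t) h3).le.not_gt
    have hhigh : s * γ.θ t ≤ Real.pi := by
      have := γ.neg_pi_le_θ t
      have := γ.θ_le_pi t
      rcases hs with rfl | rfl <;> linarith
    have := norm_sub_le_of_arc hG (Real.log (γ.r t)) s (s * γ.θ t) hs hlow hhigh
    rw [hss] at this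
    exact this
  simpa using (hL.comp hlog).sub hdiff

theorem tendsto_integral_kernel (γ : HankelContour) {z : ℝ} (hz : 0 < z)
    (hzint : ∀ m : ℤ, z ≠ (m : ℝ)) :
    Tendsto (fun p : ℝ × ℝ =>
        1 / (2 * (Real.pi : ℂ) * Complex.I) * ∫ t in p.1..p.2, γ.kernel z t)
      (atBot ×ˢ atTop) (𝓝 (1 / Complex.Gamma (z : ℂ))) := by
  obtain ⟨hN, hN'⟩ := floor_toNat_lt_and_lt hz hzint
  obtain ⟨G, hG'⟩ := (differentiable_logKernel ⌊z⌋.toNat z).isExactOn_univ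
  have hG : ∀ w, HasDerivAt G (logKernel ⌊z⌋.toNat z w) w := fun w => hG' w (Set.mem_univ w)
  obtain ⟨L, hL, hjump⟩ := exists_tendsto_banks hz hN hN' hG
  have htop := γ.tendsto_comp_logPoint hz hN hG (Or.inl rfl) (hL 1 (Or.inl rfl)) γ.re_atTop
    (by simpa using γ.above_atTop)
  have hbot := γ.tendsto_comp_logPoint hz hN hG (Or.inr rfl) (hL (-1) (Or.inr rfl)) γ.re_atBot
    (by simpa using γ.below_atBot)
  have hlim := ((htop.comp tendsto_snd).sub (hbot.comp tendsto_fst)).const_mul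
    (1 / (2 * (Real.pi : ℂ) * Complex.I))
  have hval : 1 / (2 * (Real.pi : ℂ) * Complex.I) * (L 1 - L (-1))
      = 1 / Complex.Gamma (z : ℂ) := by
    have hreal : (1 / Real.Gamma z : ℂ)
        = ((Real.sin (Real.pi * z) / Real.pi * Real.Gamma (1 - z) : ℝ) : ℂ) := by
      rw [← one_div_Gamma_eq_sin_mul_Gamma hz hzint]
      push_cast
      rfl
    rw [hjump, Complex.Gamma_ofReal, hreal, Complex.ofReal_mul, Complex.ofReal_mul,
      Complex.ofReal_div]
    have h1 : (Real.pi : ℂ) ≠ 0 := by exact_mod_cast Real.pi_ne_zero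
    have h2 := Complex.I_ne_zero
    field_simp
  rw [hval] at hlim
  refine hlim.congr fun p => ?_
  rw [(γ.intervalIntegrable_kernel_and_integral_eq z hG p.1 p.2).2]
  rfl

theorem intervalIntegrable_kernel (γ : HankelContour) (z a b : ℝ) :
    IntervalIntegrable (γ.kernel z) volume a b := by
  obtain ⟨G, hG⟩ := (differentiable_logKernel ⌊z⌋.toNat z).isExactOn_univ
  exact (γ.intervalIntegrable_kernel_and_integral_eq z (fun w => hG w (Set.mem_univ w)) a b).1

/-! ### Absolute convergence on the standard contour -/

theorem norm_kernel_wedge_le {ε δ : ℝ} (hε : 0 < ε) (hδ : Real.pi / 2 < δ) (hδ' : δ ≤ Real.pi)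
    (z : ℝ) {t : ℝ} (ht : ε < |t|) : ‖(wedge ε δ hε hδ hδ').kernel z t‖ ≤
      (Real.exp (Real.cos δ * |t|)
        + ∑ k ∈ Finset.range ⌊z⌋.toNat, |t| ^ k / (k.factorial : ℝ)) / |t| ^ z := by
  have h0 : 0 < |t| := hε.trans ht
  -- The sign `c` of `t` selects the ray. The formulas are needed on a neighbourhood of `t`, to
  -- differentiate the path there; its speed is `1`.
  obtain ⟨c, hc, hev⟩ : ∃ c : ℝ, (c = 1 ∨ c = -1) ∧ ∀ᶠ u in 𝓝 t, |u| = c * u ∧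
      (wedge ε δ hε hδ hδ').r u = c * u ∧ (wedge ε δ hε hδ hδ').θ u = c * δ := by
    rcases lt_abs.1 ht with h | h
    · refine ⟨1, Or.inl rfl, ?_⟩
      filter_upwards [lt_mem_nhds h] with u hu
      have h1 : 1 ≤ u / ε := by rw [le_div_iff₀ hε]; linarith
      have h2 : |u| = u := abs_of_pos (hε.trans hu)
      simp only [wedge, h2, min_eq_left h1]
      rw [max_eq_right hu.le, max_eq_right (by norm_num)]
      simp
    · refine ⟨-1, Or.inr rfl, ?_⟩
      filter_upwards [gt_mem_nhds (lt_neg.1 h)] with u hu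
      have h1 : u / ε ≤ -1 := by rw [div_le_iff₀ hε]; linarith
      have h2 : |u| = -u := abs_of_neg (by linarith)
      simp only [wedge, h2]
      rw [max_eq_right (by linarith), min_eq_right (by linarith), max_eq_left h1]
      simp
  obtain ⟨e1, e2, e3⟩ := hev.self_of_nhds
  rw [← e1] at e2
  have hcos : Real.cos (c * δ) = Real.cos δ := by rcases hc with rfl | rfl <;> simp
  have hpoint : (wedge ε δ hε hδ hδ').point t
      = (|t| : ℝ) * Complex.exp ((c * δ : ℝ) * Complex.I) := by rw [point, e2, e3]
  have hder : HasDerivAt (wedge ε δ hε hδ hδ').point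
      (c * Complex.exp ((c * δ : ℝ) * Complex.I)) t := by
    have h1 : HasDerivAt (fun u : ℝ => ((c * u : ℝ) : ℂ)) c t := by
      simpa using ((hasDerivAt_id t).const_mul c).ofReal_comp
    refine (h1.mul_const (Complex.exp ((c * δ : ℝ) * Complex.I))).congr_of_eventuallyEq ?_
    filter_upwards [hev] with u hu
    rw [point, hu.2.1, hu.2.2]
  have hnd : ‖(c : ℂ) * Complex.exp ((c * δ : ℝ) * Complex.I)‖ = 1 := by
    rw [norm_mul, Complex.norm_exp_ofReal_mul_I, mul_one, Complex.norm_real, Real.norm_eq_abs]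
    rcases hc with rfl | rfl <;> simp
  have hpow : ‖(wedge ε δ hε hδ hδ').pow z t‖ = |t| ^ z := by
    rw [pow, norm_mul, Complex.norm_exp_ofReal_mul_I, mul_one, Complex.norm_real, e2,
      Real.norm_of_nonneg (Real.rpow_pos_of_pos h0 z).le]
  have hnp : ‖(wedge ε δ hε hδ hδ').point t‖ = |t| := by
    rw [hpoint, norm_mul, Complex.norm_exp_ofReal_mul_I, mul_one, Complex.norm_real,
      Real.norm_eq_abs, abs_abs]
  have hre : ((wedge ε δ hε hδ hδ').point t).re = Real.cos δ * |t| := by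
    rw [hpoint, Complex.re_ofReal_mul, Complex.exp_ofReal_mul_I_re, hcos, mul_comm]
  rw [kernel_eq, norm_mul, norm_div, hder.deriv, hnd, mul_one, hpow]
  refine div_le_div_of_nonneg_right ((norm_expRem_le' _ _).trans_eq ?_)
    (Real.rpow_pos_of_pos h0 z).le
  rw [hnp, hre]

theorem integrable_kernel_wedge {ε δ : ℝ} (hε : 0 < ε) (hδ : Real.pi / 2 < δ)
    (hδ' : δ ≤ Real.pi) {z : ℝ} (hz : 0 < z) (hzint : ∀ m : ℤ, z ≠ (m : ℝ)) :
    Integrable ((wedge ε δ hε hδ hδ').kernel z) := by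
  have hcos : Real.cos δ < 0 :=
    Real.cos_neg_of_pi_div_two_lt_of_lt hδ (by linarith [Real.pi_pos])
  let ρ : ℝ → ℝ := fun x => (Real.exp (Real.cos δ * x)
    + ∑ k ∈ Finset.range ⌊z⌋.toNat, x ^ k / (k.factorial : ℝ)) / x ^ z
  have hρ : IntegrableOn ρ (Set.Ioi 1) :=
    integrableOn_exp_add_sum_div hz (floor_toNat_lt_and_lt hz hzint).1 hcos
  have hρ' : IntegrableOn (ρ ∘ Neg.neg) (Set.Iio (-1)) := by
    have := ((Measure.measurePreserving_neg volume).integrableOn_comp_preimage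
      (MeasurableEquiv.neg ℝ).measurableEmbedding).2 hρ
    simpa using this
  have hloc : LocallyIntegrable ((wedge ε δ hε hδ hδ').kernel z) :=
    fun x => ⟨Set.Ioc (x - 1) (x + 1), Ioc_mem_nhds (by linarith) (by linarith),
      (intervalIntegrable_kernel _ z _ _).1⟩
  refine hloc.integrable_of_isBigO_atBot_atTop
    (.of_bound 1 ?_) ⟨_, Iio_mem_atBot (-1), hρ'⟩ (.of_bound 1 ?_) ⟨_, Ioi_mem_atTop 1, hρ⟩
  · filter_upwards [eventually_lt_atBot (-ε)] with t ht
    have h : |t| = -t := abs_of_neg (by linarith)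
    have := norm_kernel_wedge_le hε hδ hδ' z (t := t) (by linarith)
    rw [one_mul]
    rw [h] at this
    exact this.trans (Real.le_norm_self _)
  · filter_upwards [eventually_gt_atTop ε] with t ht
    have h : |t| = t := abs_of_pos (by linarith)
    have := norm_kernel_wedge_le hε hδ hδ' z (t := t) (by linarith)
    rw [one_mul]
    rw [h] at this
    exact this.trans (Real.le_norm_self _)

end HankelContour

/-- The regularized Hankel integral along every Hankel contour, as a convergent improper
integral, and along the standard one with rays `arg τ = ±δ` and an arc of radius `ε`, as an
absolutely convergent integral, equals `1 / Γ(z)`, which also equals the (absolutely convergent)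
real integral. -/
theorem theorem2 (z : ℝ) (hz : 0 < z) (hzint : ∀ m : ℤ, z ≠ (m : ℝ)) :
    (∀ γ : HankelContour,
      (∀ a b : ℝ, IntervalIntegrable (γ.kernel z) volume a b) ∧
      Tendsto (fun p : ℝ × ℝ =>
          1 / (2 * (Real.pi : ℂ) * Complex.I) * ∫ t in p.1..p.2, γ.kernel z t)
        (atBot ×ˢ atTop) (𝓝 (1 / Complex.Gamma (z : ℂ)))) ∧
    (∀ (ε δ : ℝ) (hε : 0 < ε) (hδ : Real.pi / 2 < δ) (hδ' : δ ≤ Real.pi),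
      Integrable ((HankelContour.wedge ε δ hε hδ hδ').kernel z) ∧
      1 / Complex.Gamma (z : ℂ) = 1 / (2 * (Real.pi : ℂ) * Complex.I) *
        ∫ t : ℝ, (HankelContour.wedge ε δ hε hδ hδ').kernel z t) ∧
    IntegrableOn (fun τ : ℝ => (Real.exp (-τ) - truncExp (⌊z⌋ - 1) (-τ)) / τ ^ z)
      (Set.Ioi 0) ∧
    1 / Real.Gamma z = Real.sin (Real.pi * z) / Real.pi *
      ∫ τ in Set.Ioi (0 : ℝ), (Real.exp (-τ) - truncExp (⌊z⌋ - 1) (-τ)) / τ ^ z := by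
  obtain ⟨hN, hN'⟩ := floor_toNat_lt_and_lt hz hzint
  simp_rw [truncExp_eq_negExpRem]
  refine ⟨fun γ => ⟨γ.intervalIntegrable_kernel z, γ.tendsto_integral_kernel hz hzint⟩,
    fun ε δ hε hδ hδ' => ?_, integrableOn_negExpRem_div hz hN hN', ?_⟩
  · have hint := HankelContour.integrable_kernel_wedge hε hδ hδ' hz hzint
    -- For an integrable kernel the improper integral and the Lebesgue integral are limits of the
    -- same truncations.
    exact ⟨hint, tendsto_nhds_unique (HankelContour.tendsto_integral_kernel _ hz hzint)
      ((intervalIntegral_tendsto_integral hint tendsto_fst tendsto_snd).const_mul _)⟩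
  · rw [integral_negExpRem_div hz hN hN', one_div_Gamma_eq_sin_mul_Gamma hz hzint]
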